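/- Let $n\ge 2$, let $\delta,\tau\in(0,1)$ and let $\Omega\subset\mathbb R^n$ be a domain, i.e. a nonempty connected open set. Write $d(y)=\operatorname{dist}(y,\partial\Omega)$, with $d\equiv+\infty$ if $\Omega=\mathbb R^n$, and let \[ \mathcal W^{\delta,1}(\Omega)=\Big\{f\in L^1(\Omega):\ \int_\Omega\int_{\{x\in\Omega:\,|x-y|<\tau d(y)\}}\frac{|f(x)-f(y)|}{|x-y|^{n+\delta}}\,dx\,dy<\infty\Big\} \] be the improved fractional Sobolev space (with parameter $\tau$). A point $x\in\Omega$ is a Lebesgue point of $f\in L^1(\Omega)$ if there is $a\in\mathbb R$ such that $\lim_{r\to0^+}\frac1{|B(x,r)|}\int_{B(x,r)}|f(y)-a|\,dy=0$; let $\mathcal L_f$ be the set of Lebesgue points of $f$. For $\beta>0$ and $U\subset\mathbb R^n$, the $\beta$-dimensional Hausdorff content of $U$ is \[ \mathcal H^\beta_\infty(U)=\inf\Big\{\sum_{i=0}^\infty\omega_\beta r_i^\beta:\ U\subset\bigcup_{i=0}^\infty B(x_i,r_i),\ r_i>0\Big\},\qquad \omega_\beta=\frac{\pi^{\beta/2}}{\Gamma(\beta/2+1)},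 \] where $B(x,r)$ denotes the open ball. Then for every $\beta\ge n-\delta$ and every $f\in\mathcal W^{\delta,1}(\Omega)$, \[ \mathcal H^\beta_\infty(\Omega\setminus\mathcal L_f)=0 . \] -/

import Mathlib

open MeasureTheory Metric Set Filter Topology
open scoped ENNReal

noncomputable section

/-- The constant `ω_α = π ^ (α / 2) / Γ(α / 2 + 1)`; for a natural number `α` it is the volume of
the unit ball of `ℝ^α`. -/
def omegaConst (α : ℝ) : ℝ :=
  Real.pi ^ (α / 2) / Real.Gamma (α / 2 + 1)

/-- The `α`-dimensional Hausdorff content of a set `U ⊆ ℝⁿ`: the infimum of `∑ ω_α r_i ^ α` over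
all countable coverings of `U` by open balls `B(x_i, r_i)`, with no bound on the radii. -/
def hausdorffContent {n : ℕ} (α : ℝ) (U : Set (EuclideanSpace ℝ (Fin n))) : ℝ≥0∞ :=
  ⨅ (x : ℕ → EuclideanSpace ℝ (Fin n)) (r : ℕ → ℝ) (_ : ∀ i, 0 < r i)
    (_ : U ⊆ ⋃ i, ball (x i) (r i)), ∑' i, ENNReal.ofReal (omegaConst α * r i ^ α)

/-- The set `{x ∈ Ω : |x - y| < τ dist(y, ∂Ω)}`. The distance is extended-valued: it is `∞` when
the boundary is empty, that is, when `Ω` is the whole space. -/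
def nearSet {n : ℕ} (τ : ℝ) (Ω : Set (EuclideanSpace ℝ (Fin n))) (y : EuclideanSpace ℝ (Fin n)) :
    Set (EuclideanSpace ℝ (Fin n)) :=
  {x ∈ Ω | edist x y < ENNReal.ofReal τ * infEDist y (frontier Ω)}

/-- The improved fractional Sobolev energy
`∫_Ω ∫_{|x - y| < τ dist(y, ∂Ω)} |f x - f y| / |x - y| ^ (n + δ) dx dy`. Only the values of `f` on
`Ω` enter. -/
def improvedEnergy {n : ℕ} (δ τ : ℝ) (Ω : Set (EuclideanSpace ℝ (Fin n)))
    (f : EuclideanSpace ℝ (Fin n) → ℝ) : ℝ≥0∞ :=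
  ∫⁻ y in Ω, ∫⁻ x in nearSet τ Ω y,
    ENNReal.ofReal (|f x - f y| / dist x y ^ ((n : ℝ) + δ))

/-- The improved fractional Sobolev space `𝒲^{δ,1}(Ω)` (with parameter `τ`): the functions in
`L¹(Ω)` of finite improved fractional Sobolev energy. -/
def improvedSobolev {n : ℕ} (δ τ : ℝ) (Ω : Set (EuclideanSpace ℝ (Fin n))) :
    Set (EuclideanSpace ℝ (Fin n) → ℝ) :=
  {f | IntegrableOn f Ω ∧ improvedEnergy δ τ Ω f < ∞}

/-- The Lebesgue points in the open set `Ω` of a function `f` on `Ω`: the points `x ∈ Ω` for which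
there is a real `a` such that the mean of `|f - a|` over `B(x, r)` tends to `0` as `r → 0+`.
As `Ω` is open, `B(x, r) ⊆ Ω` for small `r`, so only the values of `f` on `Ω` enter. -/
def lebesguePoints {n : ℕ} (Ω : Set (EuclideanSpace ℝ (Fin n)))
    (f : EuclideanSpace ℝ (Fin n) → ℝ) : Set (EuclideanSpace ℝ (Fin n)) :=
  {x ∈ Ω | ∃ a : ℝ,
    Tendsto (fun r : ℝ => ⨍⁻ y in ball x r, ENNReal.ofReal |f y - a| ∂volume) (𝓝[>] 0) (𝓝 0)}

end

/-! Attach to each dyadic cube of side `2⁻ᵏ`, `k ≥ 0`, the weight `A k z`: up to a constant, the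
mean over pairs in its block of neighbouring cubes of `|x - y| ^ (n + δ)` times the energy kernel.
Three facts give the theorem.

Energy (`tsum_dyadicMean_le`): `∑ 2 ^ (-k (n - δ)) A k z` is at most a constant times the energy,
because for a fixed pair the sum over scales is a geometric series cut off at `2⁻ᵏ ≈ |x - y|`.

Coarea (`hausdorffContent_dyadic_sum_eq_top`): for each level `θ`, the cubes at which the partial
sums of `A` first exceed `θ` cover the set where `∑ A` diverges. A cube is selected for a set of
positive `θ` of length at most `A k z`, so the covering cost integrated over all `θ > 0` is bounded
by the finite sum above. Hence content times `t` is bounded for all `t`, and the content is zero.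

Oscillation (`mem_lebesguePoints_of_tsum_dyadicMean_ne_top`): near a point of `Ω` the weights
dominate mean oscillations of `f` on small balls. Where `∑ A` converges, the means over these balls
are Cauchy and their limit is the Lebesgue value. -/

/-! ### Dyadic cubes -/

/-- The index of the dyadic cube of side `2⁻ᵏ` that contains `x`. -/
noncomputable def dyadicIndex {n : ℕ} (k : ℕ) (x : EuclideanSpace ℝ (Fin n)) : Fin n → ℤ :=
  fun i => ⌊2 ^ k * x i⌋

/-- The lower corner of the dyadic cube of side `2⁻ᵏ` with index `z`. -/
noncomputable def dyadicCorner {n : ℕ} (k : ℕ) (z : Fin n → ℤ) : EuclideanSpace ℝ (Fin n) :=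
  WithLp.toLp 2 fun i => (z i : ℝ) / 2 ^ k

theorem EuclideanSpace.dist_le_sqrt_mul {n : ℕ} {x y : EuclideanSpace ℝ (Fin n)} {c : ℝ}
    (hc : 0 ≤ c) (h : ∀ i, |x i - y i| ≤ c) : dist x y ≤ √n * c := by
  rw [EuclideanSpace.dist_eq]
  calc √(∑ i, dist (x i) (y i) ^ 2) ≤ √(∑ _i : Fin n, c ^ 2) := by
        gcongr with i
        rw [Real.dist_eq]
        exact h i
    _ = √n * c := by
        simp [Real.sqrt_mul, Real.sqrt_sq hc]

theorem dyadicIndex_dyadicCorner {n : ℕ} (k : ℕ) (z : Fin n → ℤ) :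
    dyadicIndex k (dyadicCorner k z) = z := by
  ext i
  have h : (2 : ℝ) ^ k ≠ 0 := by positivity
  simp [dyadicIndex, dyadicCorner, mul_div_cancel₀ _ h]

theorem dyadicIndex_eq_of_succ {n k : ℕ} {x y : EuclideanSpace ℝ (Fin n)}
    (h : dyadicIndex (k + 1) x = dyadicIndex (k + 1) y) : dyadicIndex k x = dyadicIndex k y := by
  have key : ∀ t : ℝ, ⌊2 ^ k * t⌋ = ⌊2 ^ (k + 1) * t⌋ / 2 := by
    intro t
    have := Int.floor_div_natCast (2 ^ (k + 1) * t) 2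
    rw [Nat.cast_ofNat, Nat.cast_ofNat] at this
    rw [← this]
    congr 1
    ring
  ext i
  simp only [dyadicIndex]
  rw [key, key]
  exact congrArg (· / 2) (congrFun h i)

theorem dyadicIndex_eq_of_le {n j k : ℕ} {x y : EuclideanSpace ℝ (Fin n)} (hjk : j ≤ k)
    (h : dyadicIndex k x = dyadicIndex k y) : dyadicIndex j x = dyadicIndex j y := by
  induction k, hjk using Nat.le_induction with
  | base => exact h
  | succ k _ ih => exact ih (dyadicIndex_eq_of_succ h)

theorem dist_dyadicCorner_lt {n : ℕ} (k : ℕ) (x : EuclideanSpace ℝ (Fin n)) :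
    dist x (dyadicCorner k (dyadicIndex k x)) < (√n + 1) * (2 ^ k)⁻¹ := by
  have hk : (0 : ℝ) < 2 ^ k := by positivity
  have h : dist x (dyadicCorner k (dyadicIndex k x)) ≤ √n * (2 ^ k)⁻¹ := by
    refine EuclideanSpace.dist_le_sqrt_mul (by positivity) fun i => ?_
    have h1 := Int.floor_le (2 ^ k * x i)
    have h2 := Int.lt_floor_add_one (2 ^ k * x i)
    simp only [dyadicCorner, dyadicIndex]
    have : x i - (⌊2 ^ k * x i⌋ : ℝ) / 2 ^ k = (2 ^ k * x i - ⌊2 ^ k * x i⌋) * (2 ^ k)⁻¹ := by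
      field_simp
    rw [this, abs_of_nonneg (mul_nonneg (by linarith) (by positivity))]
    exact mul_le_of_le_one_left (by positivity) (by linarith)
  have : (0 : ℝ) < (2 ^ k)⁻¹ := by positivity
  linarith

/-! ### Hausdorff content and the coarea estimate -/

theorem omegaConst_pos {α : ℝ} (hα : 0 < α) : 0 < omegaConst α :=
  div_pos (Real.rpow_pos_of_pos Real.pi_pos _) (Real.Gamma_pos_of_pos (by linarith))

/-- The content is bounded by the cost of any covering by balls indexed by a subset of a denumerable
type. -/
theorem hausdorffContent_le_tsum_indicator {n : ℕ} {ι : Type*} [Denumerable ι] {α : ℝ} (hα : 0 < α)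
    {U : Set (EuclideanSpace ℝ (Fin n))} (x : ι → EuclideanSpace ℝ (Fin n)) (r : ι → ℝ)
    (hr : ∀ i, 0 < r i) (J : Set ι) (hU : U ⊆ ⋃ i ∈ J, ball (x i) (r i)) :
    hausdorffContent α U ≤
      ∑' i, J.indicator (fun i => ENNReal.ofReal (omegaConst α * r i ^ α)) i := by
  classical
  refine ENNReal.le_of_forall_pos_le_add fun ε hε _ => ?_
  obtain ⟨e, he, hsum⟩ := ENNReal.exists_pos_sum_of_countable
    (ENNReal.coe_ne_zero.2 hε.ne') ι
  have hω := omegaConst_pos hα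
  have hpos : ∀ i, 0 < ((e i : ℝ) / omegaConst α) := fun i =>
    div_pos (by exact_mod_cast he i) hω
  -- Every radius of a covering must be positive, so an unused index gets a ball of cost exactly `e
  -- i`.
  let ρ : ι → ℝ := fun i => if i ∈ J then r i else ((e i : ℝ) / omegaConst α) ^ α⁻¹
  have hρ : ∀ i, 0 < ρ i := by
    intro i
    by_cases hi : i ∈ J
    · simpa [ρ, hi] using hr i
    · simpa [ρ, hi] using Real.rpow_pos_of_pos (hpos i) _
  let φ : ℕ ≃ ι := (Denumerable.eqv ι).symm
  calc hausdorffContent α U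
      ≤ ∑' j, ENNReal.ofReal (omegaConst α * ρ (φ j) ^ α) := by
        refine iInf₂_le_of_le (fun j => x (φ j)) (fun j => ρ (φ j)) ?_
        refine iInf₂_le_of_le (fun j => hρ _) ?_ le_rfl
        intro y hy
        obtain ⟨i, hi, hyi⟩ := mem_iUnion₂.1 (hU hy)
        refine mem_iUnion.2 ⟨φ.symm i, ?_⟩
        simpa [ρ, hi] using hyi
    _ = ∑' i, ENNReal.ofReal (omegaConst α * ρ i ^ α) :=
        φ.tsum_eq fun i => ENNReal.ofReal (omegaConst α * ρ i ^ α)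
    _ ≤ ∑' i, (J.indicator (fun i => ENNReal.ofReal (omegaConst α * r i ^ α)) i + e i) := by
        refine ENNReal.tsum_le_tsum fun i => ?_
        by_cases hi : i ∈ J
        · simp [ρ, hi]
        · simp only [ρ, hi, if_false, indicator_of_notMem, not_false_eq_true, zero_add]
          rw [← Real.rpow_mul (hpos i).le, inv_mul_cancel₀ hα.ne', Real.rpow_one,
            mul_div_cancel₀ _ hω.ne', ENNReal.ofReal_coe_nnreal]
    _ ≤ _ := by
        rw [ENNReal.tsum_add]
        gcongr

/-- Coarea estimate: if the nonnegative weights `A k z` on dyadic cubes satisfy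
`∑ 2 ^ (-k s) A k z < ∞`, then the set of points at which the sum of the weights over the cubes
containing the point diverges has vanishing `β`-dimensional content for `β ≥ s`. -/
theorem hausdorffContent_dyadic_sum_eq_top {n : ℕ} [NeZero n] {s β : ℝ} (hs : 0 < s) (hβ : s ≤ β)
    (A : ℕ → (Fin n → ℤ) → ℝ≥0∞)
    (hA : ∑' i : ℕ × (Fin n → ℤ), ENNReal.ofReal (((2 : ℝ) ^ i.1) ^ (-s)) * A i.1 i.2 ≠ ∞) :
    hausdorffContent β {x | ∑' k, A k (dyadicIndex k x) = ∞} = 0 := by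
  classical
  have hβ0 : 0 < β := hs.trans_le hβ
  set ι := ℕ × (Fin n → ℤ)
  have : Denumerable ι := Denumerable.ofEncodableOfInfinite ι
  set M := ∑' i : ι, ENNReal.ofReal (((2 : ℝ) ^ i.1) ^ (-s)) * A i.1 i.2 with hM
  let S : ℕ → EuclideanSpace ℝ (Fin n) → ℝ≥0∞ := fun k x =>
    ∑ j ∈ Finset.range k, A j (dyadicIndex j x)
  have hS : ∀ k x y, dyadicIndex k x = dyadicIndex k y → S k x = S k y := fun k x y h =>
    Finset.sum_congr rfl fun j hj => by
      rw [dyadicIndex_eq_of_le (Finset.mem_range.1 hj).le h]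
  -- The levels `θ` that the partial sums cross at cube `i`; `S k` is constant on cubes of side
  -- `2⁻ᵏ`, so its value at the corner serves the whole cube.
  let T : ι → Set ℝ := fun i =>
    {θ | S i.1 (dyadicCorner i.1 i.2) ≤ ENNReal.ofReal θ ∧
      ENNReal.ofReal θ < S i.1 (dyadicCorner i.1 i.2) + A i.1 i.2}
  have hTm : ∀ i, MeasurableSet (T i) := fun i =>
    (measurableSet_le measurable_const ENNReal.measurable_ofReal).inter
      (measurableSet_lt ENNReal.measurable_ofReal measurable_const)
  let w : ι → ℝ≥0∞ := fun i => ENNReal.ofReal (((2 : ℝ) ^ i.1) ^ (-s))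
  let cost : ℝ → ℝ≥0∞ := fun θ => ∑' i, (T i).indicator (fun _ => w i) θ
  -- `ENNReal.ofReal` sends every negative `θ` to `0`, so only positive levels are measured.
  have hTvol : ∀ i (t : ℝ), volume (T i ∩ Ioo 0 t) ≤ A i.1 i.2 := by
    intro i t
    set a := S i.1 (dyadicCorner i.1 i.2) with ha
    by_cases hAt : A i.1 i.2 = ∞
    · simp [hAt]
    by_cases hat : a = ∞
    · have : T i = ∅ := by
        ext θ
        simp [T, ← ha, hat]
      simp [this]
    calc volume (T i ∩ Ioo 0 t) ≤ volume (Ico a.toReal (a.toReal + (A i.1 i.2).toReal)) := by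
          refine measure_mono ?_
          rintro θ ⟨⟨h1, h2⟩, h3, -⟩
          rw [← ha] at h1 h2
          refine ⟨ENNReal.toReal_le_of_le_ofReal h3.le h1, ?_⟩
          rw [← ENNReal.toReal_add hat hAt]
          exact (ENNReal.ofReal_lt_iff_lt_toReal h3.le (ENNReal.add_ne_top.2 ⟨hat, hAt⟩)).1 h2
      _ ≤ A i.1 i.2 := by
          rw [Real.volume_Ico, add_sub_cancel_left, ENNReal.ofReal_toReal hAt]
  have hint : ∀ t : ℝ, ∫⁻ θ in Ioo 0 t, cost θ ≤ M := by
    intro t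
    rw [lintegral_tsum fun i => (measurable_const.indicator (hTm i)).aemeasurable]
    refine ENNReal.tsum_le_tsum fun i => ?_
    rw [lintegral_indicator_const (hTm i), Measure.restrict_apply (hTm i)]
    exact mul_le_mul_right (hTvol i t) _
  set C := ENNReal.ofReal (omegaConst β * (√n + 1) ^ β) with hC
  have hcov : ∀ θ : ℝ, hausdorffContent β {x | ∑' k, A k (dyadicIndex k x) = ∞} ≤ C * cost θ := by
    intro θ
    have h1 := hausdorffContent_le_tsum_indicator hβ0
      (U := {x | ∑' k, A k (dyadicIndex k x) = ∞})
      (fun i : ι => dyadicCorner i.1 i.2) (fun i => (√n + 1) * (2 ^ i.1)⁻¹)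
      (fun i => by positivity) {i | θ ∈ T i} ?_
    · refine h1.trans ?_
      rw [← ENNReal.tsum_mul_left]
      refine ENNReal.tsum_le_tsum fun i => ?_
      by_cases hi : θ ∈ T i
      · rw [indicator_of_mem (by exact hi), indicator_of_mem hi, hC,
          ← ENNReal.ofReal_mul (mul_nonneg (omegaConst_pos hβ0).le (by positivity))]
        refine ENNReal.ofReal_le_ofReal ?_
        rw [Real.mul_rpow (by positivity) (by positivity), ← mul_assoc]
        refine mul_le_mul_of_nonneg_left ?_
          (mul_nonneg (omegaConst_pos hβ0).le (by positivity))
        rw [Real.inv_rpow (by positivity), ← Real.rpow_neg (by positivity)]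
        -- The only sides are `2⁻ᵏ ≤ 1`, so raising the exponent from `s` to `β` lowers the cost.
        exact Real.rpow_le_rpow_of_exponent_le (one_le_pow₀ one_le_two) (by linarith)
      · rw [indicator_of_notMem (by exact hi)]
        exact zero_le
    · intro x hx
      have hx' : ∑' k, A k (dyadicIndex k x) = ∞ := hx
      have hex : ∃ k, ENNReal.ofReal θ < S k x := by
        rw [ENNReal.tsum_eq_iSup_nat] at hx'
        exact lt_iSup_iff.1 (hx' ▸ ENNReal.ofReal_lt_top)
      have hfind := Nat.find_spec hex
      have hmin := fun m => Nat.find_min hex (m := m)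
      generalize Nat.find hex = m at hfind hmin
      cases m with
      | zero => simp [S] at hfind
      | succ k =>
        have hk := dyadicIndex_dyadicCorner k (dyadicIndex k x)
        refine mem_iUnion₂.2 ⟨(k, dyadicIndex k x), ⟨?_, ?_⟩, ?_⟩
        · exact (hS k _ _ hk).trans_le (not_lt.1 (hmin k k.lt_succ_self))
        · simp only
          rw [hS k _ _ hk]
          simpa [S, Finset.sum_range_succ] using hfind
        · exact dist_dyadicCorner_lt k x
  have hmul : ∀ t : ℝ, 0 < t →
      hausdorffContent β {x | ∑' k, A k (dyadicIndex k x) = ∞} * ENNReal.ofReal t ≤ C * M := by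
    intro t ht
    calc _ = ∫⁻ _θ in Ioo 0 t, hausdorffContent β {x | ∑' k, A k (dyadicIndex k x) = ∞} := by
          rw [setLIntegral_const, Real.volume_Ioo, sub_zero]
      _ ≤ ∫⁻ θ in Ioo 0 t, C * cost θ := lintegral_mono fun θ => hcov θ
      _ = C * ∫⁻ θ in Ioo 0 t, cost θ := lintegral_const_mul' _ _ ENNReal.ofReal_ne_top
      _ ≤ C * M := mul_le_mul_right (hint t) _
  by_contra h0
  have htop : Tendsto (fun t : ℝ => hausdorffContent β {x | ∑' k, A k (dyadicIndex k x) = ∞} *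
      ENNReal.ofReal t) atTop (𝓝 ∞) := by
    have := ENNReal.Tendsto.const_mul (a := hausdorffContent β
      {x | ∑' k, A k (dyadicIndex k x) = ∞}) ENNReal.tendsto_ofReal_atTop (Or.inl ENNReal.top_ne_zero)
    rwa [ENNReal.mul_top h0] at this
  have hle : ∞ ≤ C * M := le_of_tendsto htop ((eventually_gt_atTop 0).mono hmul)
  exact ENNReal.mul_ne_top ENNReal.ofReal_ne_top hA (top_le_iff.1 hle)

/-! ### Summing the energy over dyadic scales -/

/-- The lower integral is superadditive without any measurability, so the energy kernel needs none.
-/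
theorem MeasureTheory.tsum_lintegral_le {α ι : Type*} [MeasurableSpace α] (μ : Measure α)
    (F : ι → α → ℝ≥0∞) : ∑' i, ∫⁻ a, F i a ∂μ ≤ ∫⁻ a, ∑' i, F i a ∂μ := by
  classical
  rw [ENNReal.tsum_eq_iSup_sum]
  refine iSup_le fun s => ?_
  refine le_trans ?_ (lintegral_mono fun a => ENNReal.sum_le_tsum s)
  induction s using Finset.induction_on with
  | empty => simp
  | insert i s hi ih =>
    simp only [Finset.sum_insert hi]
    exact (add_le_add_right ih _).trans (le_lintegral_add _ _)

theorem ENNReal.tsum_ite_geometric_le {q u T : ℝ} (hq : 2 ≤ q) (hu : 0 ≤ u) (hT : 0 ≤ T) :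
    ∑' k : ℕ, (if q ^ k * u ≤ T then ENNReal.ofReal (q ^ k * u) else 0) ≤
      ENNReal.ofReal (2 * T) := by
  have hqk : ∀ k : ℕ, 0 ≤ q ^ k * u := fun k => by positivity
  -- The second bound drives the first: when the `N`-th term is admitted, it and all earlier terms
  -- together are at most twice that term.
  have key : ∀ N : ℕ, ∑ k ∈ Finset.range N, (if q ^ k * u ≤ T then q ^ k * u else 0) ≤ 2 * T ∧
      ∑ k ∈ Finset.range N, (if q ^ k * u ≤ T then q ^ k * u else 0) ≤ q ^ N * u := by
    intro N
    induction N with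
    | zero => simpa using ⟨hT, hu⟩
    | succ N ih =>
      have h1 : q ^ (N + 1) * u = q * (q ^ N * u) := by ring
      have h2 : 2 * (q ^ N * u) ≤ q * (q ^ N * u) := mul_le_mul_of_nonneg_right hq (hqk N)
      rw [Finset.sum_range_succ]
      split_ifs with h
      · constructor <;> linarith [ih.2]
      · constructor <;> linarith [ih.1, ih.2, hqk N]
  rw [ENNReal.tsum_eq_iSup_nat]
  refine iSup_le fun N => ?_
  refine le_trans (le_of_eq ?_) (ENNReal.ofReal_le_ofReal (key N).1)
  rw [ENNReal.ofReal_sum_of_nonneg fun k _ => by split_ifs <;> simp [hqk]]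
  exact Finset.sum_congr rfl fun k _ => by split_ifs <;> simp

/-- The points whose dyadic cube of side `2⁻ᵏ` touches the cube with index `z`. -/
def dyadicNbhd {n : ℕ} (k : ℕ) (z : Fin n → ℤ) : Set (EuclideanSpace ℝ (Fin n)) :=
  {x | z ∈ Finset.Icc (dyadicIndex k x - 1) (dyadicIndex k x + 1)}

theorem dist_le_of_mem_dyadicNbhd {n k : ℕ} {z : Fin n → ℤ} {x y : EuclideanSpace ℝ (Fin n)}
    (hx : x ∈ dyadicNbhd k z) (hy : y ∈ dyadicNbhd k z) : 2 ^ k * dist x y ≤ 3 * √n := by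
  have hk : (0 : ℝ) < 2 ^ k := by positivity
  have h : dist x y ≤ √n * (3 * (2 ^ k)⁻¹) := by
    refine EuclideanSpace.dist_le_sqrt_mul (by positivity) fun i => ?_
    rw [dyadicNbhd, mem_ofPred_eq, Finset.mem_Icc, Pi.le_def, Pi.le_def] at hx hy
    have h1 := hx.1 i
    have h2 := hx.2 i
    have h3 := hy.1 i
    have h4 := hy.2 i
    simp only [dyadicIndex, Pi.sub_apply, Pi.add_apply, Pi.one_apply] at h1 h2 h3 h4
    have h5 : (⌊2 ^ k * x i⌋ : ℝ) ≤ ⌊2 ^ k * y i⌋ + 2 := by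
      exact_mod_cast (by linarith : ⌊2 ^ k * x i⌋ ≤ ⌊2 ^ k * y i⌋ + 2)
    have h6 : (⌊2 ^ k * y i⌋ : ℝ) ≤ ⌊2 ^ k * x i⌋ + 2 := by
      exact_mod_cast (by linarith : ⌊2 ^ k * y i⌋ ≤ ⌊2 ^ k * x i⌋ + 2)
    have h7 := Int.floor_le (2 ^ k * x i)
    have h8 := Int.lt_floor_add_one (2 ^ k * x i)
    have h9 := Int.floor_le (2 ^ k * y i)
    have h10 := Int.lt_floor_add_one (2 ^ k * y i)
    have h11 : |x i - y i| * 2 ^ k = |2 ^ k * x i - 2 ^ k * y i| := by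
      rw [← mul_sub, abs_mul, abs_of_pos hk, mul_comm]
    rw [← div_eq_mul_inv, le_div_iff₀ hk, h11, abs_le]
    constructor <;> linarith
  calc 2 ^ k * dist x y ≤ 2 ^ k * (√n * (3 * (2 ^ k)⁻¹)) := by gcongr
    _ = 3 * √n := by field_simp

/-- A ball of radius `2⁻ᵏ` may leave the cube of its centre, but never the surrounding block; hence
the use of blocks. -/
theorem mem_dyadicNbhd_of_dist_lt {n k : ℕ} {x y : EuclideanSpace ℝ (Fin n)}
    (h : dist y x < (2 ^ k)⁻¹) : y ∈ dyadicNbhd k (dyadicIndex k x) := by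
  have hk : (0 : ℝ) < 2 ^ k := by positivity
  have key : ∀ i, |2 ^ k * y i - 2 ^ k * x i| < 1 := by
    intro i
    have h1 : |y i - x i| ≤ dist y x := by
      rw [dist_eq_norm]
      simpa using PiLp.norm_apply_le (y - x) i
    rw [← mul_sub, abs_mul, abs_of_pos hk]
    calc 2 ^ k * |y i - x i| < 2 ^ k * (2 ^ k)⁻¹ := by
          exact mul_lt_mul_of_pos_left (h1.trans_lt h) hk
      _ = 1 := mul_inv_cancel₀ hk.ne'
  rw [dyadicNbhd, mem_ofPred_eq, Finset.mem_Icc, Pi.le_def, Pi.le_def]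
  constructor <;> intro i
  · have := abs_lt.1 (key i)
    simp only [dyadicIndex, Pi.sub_apply, Pi.one_apply, sub_le_iff_le_add]
    rw [← Int.floor_add_one]
    exact Int.floor_le_floor (by linarith)
  · have := abs_lt.1 (key i)
    simp only [dyadicIndex, Pi.add_apply, Pi.one_apply]
    rw [← Int.floor_add_one]
    exact Int.floor_le_floor (by linarith)

theorem tsum_dyadicNbhd_indicator {n : ℕ} (k : ℕ) (x : EuclideanSpace ℝ (Fin n)) (c : ℝ≥0∞) :
    ∑' z : Fin n → ℤ, (dyadicNbhd k z).indicator (fun _ => c) x = 3 ^ n * c := by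
  classical
  set s := Finset.Icc (dyadicIndex k x - 1) (dyadicIndex k x + 1)
  have hcard : s.card = 3 ^ n := by
    have h : ∀ a : ℤ, (a + 1 + 1 - (a - 1)).toNat = 3 := fun a => by
      rw [show a + 1 + 1 - (a - 1) = 3 by ring]
      rfl
    simp [s, Pi.card_Icc, h]
  have hind : ∀ z : Fin n → ℤ,
      (dyadicNbhd k z).indicator (fun _ => c) x = if z ∈ s then c else 0 := fun z => by
    simp only [indicator_apply, dyadicNbhd, mem_ofPred_eq, s]
  rw [tsum_congr hind, tsum_eq_sum (s := s) fun z hz => if_neg hz,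
    Finset.sum_congr rfl fun z hz => if_pos hz, Finset.sum_const, hcard]
  simp

/-- The normalised mean `2 ^ (2 n k) ∬ |x - y| ^ p K(x, y)` over the dyadic neighbourhood with
index `z` at scale `2⁻ᵏ`. -/
noncomputable def dyadicMean {n : ℕ} (p : ℝ)
    (K : EuclideanSpace ℝ (Fin n) → EuclideanSpace ℝ (Fin n) → ℝ≥0∞) (k : ℕ) (z : Fin n → ℤ) :
    ℝ≥0∞ :=
  ENNReal.ofReal (((2 : ℝ) ^ k) ^ (2 * (n : ℝ))) * ∫⁻ y, ∫⁻ x,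
    (dyadicNbhd k z ×ˢ dyadicNbhd k z).indicator
      (fun q => ENNReal.ofReal (dist q.1 q.2 ^ p) * K q.1 q.2) (x, y)

/-- The factors combine to `(2 ^ k * dist x y) ^ p`. At each scale a point lies in `3 ^ n` blocks,
and both points share one only if `2 ^ k * dist x y ≤ 3 * √n`. The remaining series has ratio `2 ^ p
≥ 2`. -/
theorem tsum_dyadicMean_le {n : ℕ} {p : ℝ} (hp : 1 ≤ p)
    (K : EuclideanSpace ℝ (Fin n) → EuclideanSpace ℝ (Fin n) → ℝ≥0∞) :
    ∑' i : ℕ × (Fin n → ℤ),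
        ENNReal.ofReal (((2 : ℝ) ^ i.1) ^ (p - 2 * (n : ℝ))) * dyadicMean p K i.1 i.2 ≤
      3 ^ n * ENNReal.ofReal (2 * (3 * √n) ^ p) * ∫⁻ y, ∫⁻ x, K x y := by
  classical
  have hp0 : 0 < p := by linarith
  set c : ℕ → ℝ≥0∞ := fun k => ENNReal.ofReal (((2 : ℝ) ^ k) ^ p)
  have hq : (2 : ℝ) ≤ 2 ^ p := by
    simpa using Real.rpow_le_rpow_of_exponent_le (one_le_two (α := ℝ)) hp
  have hqk : ∀ k : ℕ, ((2 : ℝ) ^ k) ^ p = (2 ^ p) ^ k := fun k =>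
    (Real.rpow_pow_comm (by norm_num) p k).symm
  set g : EuclideanSpace ℝ (Fin n) → EuclideanSpace ℝ (Fin n) → ℕ → ℝ≥0∞ := fun x y k =>
    if (2 ^ p) ^ k * dist x y ^ p ≤ (3 * √n) ^ p then
      ENNReal.ofReal ((2 ^ p) ^ k * dist x y ^ p) else 0
  calc ∑' i : ℕ × (Fin n → ℤ),
        ENNReal.ofReal (((2 : ℝ) ^ i.1) ^ (p - 2 * (n : ℝ))) * dyadicMean p K i.1 i.2
      = ∑' i : ℕ × (Fin n → ℤ), ∫⁻ y, ∫⁻ x, c i.1 *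
          (dyadicNbhd i.1 i.2 ×ˢ dyadicNbhd i.1 i.2).indicator
            (fun q => ENNReal.ofReal (dist q.1 q.2 ^ p) * K q.1 q.2) (x, y) := by
        refine tsum_congr fun i => ?_
        have h2 : (0 : ℝ) < 2 ^ i.1 := by positivity
        rw [dyadicMean, ← mul_assoc, ← ENNReal.ofReal_mul (by positivity), ← Real.rpow_add h2,
          sub_add_cancel, ← lintegral_const_mul' _ _ ENNReal.ofReal_ne_top]
        refine lintegral_congr fun y => ?_
        rw [← lintegral_const_mul' _ _ ENNReal.ofReal_ne_top]
    _ ≤ ∫⁻ y, ∫⁻ x, ∑' i : ℕ × (Fin n → ℤ), c i.1 *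
          (dyadicNbhd i.1 i.2 ×ˢ dyadicNbhd i.1 i.2).indicator
            (fun q => ENNReal.ofReal (dist q.1 q.2 ^ p) * K q.1 q.2) (x, y) :=
        (tsum_lintegral_le _ _).trans (lintegral_mono fun y => tsum_lintegral_le _ _)
    _ ≤ ∫⁻ y, ∫⁻ x, 3 ^ n * ENNReal.ofReal (2 * (3 * √n) ^ p) * K x y := by
        refine lintegral_mono fun y => lintegral_mono fun x => ?_
        calc _ ≤ ∑' i : ℕ × (Fin n → ℤ),
              (dyadicNbhd i.1 i.2).indicator (fun _ => g x y i.1 * K x y) x := by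
              refine ENNReal.tsum_le_tsum fun i => ?_
              by_cases h : (x, y) ∈ dyadicNbhd i.1 i.2 ×ˢ dyadicNbhd i.1 i.2
              · rw [indicator_of_mem h, indicator_of_mem h.1]
                have hle : (2 ^ p) ^ i.1 * dist x y ^ p ≤ (3 * √n) ^ p := by
                  rw [← hqk, ← Real.mul_rpow (by positivity) dist_nonneg]
                  exact Real.rpow_le_rpow (by positivity) (dist_le_of_mem_dyadicNbhd h.1 h.2)
                    hp0.le
                simp only [g, if_pos hle, c, hqk]
                rw [← mul_assoc, ENNReal.ofReal_mul (by positivity)]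
              · rw [indicator_of_notMem h, mul_zero]
                exact zero_le
          _ = 3 ^ n * ((∑' k, g x y k) * K x y) := by
              rw [ENNReal.tsum_prod']
              simp only [tsum_dyadicNbhd_indicator]
              rw [ENNReal.tsum_mul_left, ENNReal.tsum_mul_right]
          _ ≤ 3 ^ n * (ENNReal.ofReal (2 * (3 * √n) ^ p) * K x y) := by
              gcongr
              exact ENNReal.tsum_ite_geometric_le hq (by positivity) (by positivity)
          _ = _ := (mul_assoc _ _ _).symm
    _ = _ := by
        have hC : (3 : ℝ≥0∞) ^ n * ENNReal.ofReal (2 * (3 * √n) ^ p) ≠ ∞ :=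
          ENNReal.mul_ne_top (by simp) ENNReal.ofReal_ne_top
        rw [← lintegral_const_mul' _ _ hC]
        exact lintegral_congr fun y => lintegral_const_mul' _ _ hC

/-! ### Mean oscillation and Lebesgue points -/

section Average

variable {α : Type*} [MeasurableSpace α] {μ : Measure α} {s : Set α} {f : α → ℝ}

theorem enorm_setAverage_sub_le (h0 : μ s ≠ 0) (hs : μ s ≠ ∞) (hf : IntegrableOn f s μ) (c : ℝ) :
    ‖(⨍ x in s, f x ∂μ) - c‖ₑ ≤ (μ s)⁻¹ * ∫⁻ x in s, ‖f x - c‖ₑ ∂μ := by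
  have : IsFiniteMeasure (μ.restrict s) := ⟨by simpa using hs.lt_top⟩
  have : NeZero (μ.restrict s) := ⟨by simpa [Measure.restrict_eq_zero] using h0⟩
  set ν := ((μ.restrict s) univ)⁻¹ • μ.restrict s with hν
  have : IsProbabilityMeasure ν := by
    rw [hν]
    infer_instance
  have hfν : Integrable f ν := hf.to_average
  have h1 : (⨍ x in s, f x ∂μ) - c = ∫ x, (f x - c) ∂ν := by
    rw [integral_sub hfν (integrable_const c), integral_const, probReal_univ, one_smul]
    rfl
  rw [h1]
  refine (enorm_integral_le_lintegral_enorm _).trans_eq ?_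
  rw [hν, lintegral_smul_measure, Measure.restrict_apply_univ, smul_eq_mul]

theorem setLIntegral_enorm_sub_setAverage_le (h0 : μ s ≠ 0) (hs : μ s ≠ ∞)
    (hf : IntegrableOn f s μ) :
    ∫⁻ y in s, ‖f y - ⨍ x in s, f x ∂μ‖ₑ ∂μ ≤
      (μ s)⁻¹ * ∫⁻ y in s, ∫⁻ x in s, ‖f x - f y‖ₑ ∂μ ∂μ := by
  rw [← lintegral_const_mul' _ _ (ENNReal.inv_ne_top.2 h0)]
  refine lintegral_mono fun y => ?_
  rw [← enorm_neg, neg_sub]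
  exact enorm_setAverage_sub_le h0 hs hf (f y)

end Average

/-- If the mean oscillations of `f` over a doubling sequence of balls shrinking to `x` are summable,
then `x` is a Lebesgue point of `f`. -/
theorem exists_tendsto_setLAverage_of_tsum_oscillation {X : Type*} [PseudoMetricSpace X]
    [MeasurableSpace X] [OpensMeasurableSpace X] {μ : Measure X} {f : X → ℝ} {x : X} {ρ : ℕ → ℝ}
    {D : ℝ≥0∞} {a : ℕ → ℝ≥0∞} (hρ : ∀ k, 0 < ρ k) (hρa : Antitone ρ)
    (hρ0 : Tendsto ρ atTop (𝓝 0)) (hD : D ≠ ∞)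
    (hV0 : ∀ k, μ (ball x (ρ k)) ≠ 0) (hV : ∀ k, μ (ball x (ρ k)) ≠ ∞)
    (hdouble : ∀ k, μ (ball x (ρ k)) ≤ D * μ (ball x (ρ (k + 1))))
    (hf : IntegrableOn f (ball x (ρ 0)) μ)
    (hosc : ∀ k, ∫⁻ y in ball x (ρ k), ∫⁻ z in ball x (ρ k), ‖f z - f y‖ₑ ∂μ ∂μ ≤
      μ (ball x (ρ k)) * (μ (ball x (ρ k)) * a k))
    (ha : ∑' k, a k ≠ ∞) :
    ∃ c : ℝ, Tendsto (fun r : ℝ => ⨍⁻ y in ball x r, ENNReal.ofReal |f y - c| ∂μ) (𝓝[>] 0)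
      (𝓝 0) := by
  set V : ℕ → ℝ≥0∞ := fun k => μ (ball x (ρ k)) with hVdef
  set m : ℕ → ℝ := fun k => ⨍ y in ball x (ρ k), f y ∂μ with hm
  have hfk : ∀ k, IntegrableOn f (ball x (ρ k)) μ := fun k =>
    hf.mono_set (ball_subset_ball (hρa k.zero_le))
  have hdev : ∀ k, ∫⁻ y in ball x (ρ k), ‖f y - m k‖ₑ ∂μ ≤ V k * a k := by
    intro k
    refine (setLIntegral_enorm_sub_setAverage_le (hV0 k) (hV k) (hfk k)).trans ?_
    calc (V k)⁻¹ * _ ≤ (V k)⁻¹ * (V k * (V k * a k)) := mul_le_mul_right (hosc k) _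
      _ = V k * a k := by rw [← mul_assoc, ENNReal.inv_mul_cancel (hV0 k) (hV k), one_mul]
  have hinv : ∀ k, (V (k + 1))⁻¹ * V k ≤ D := by
    intro k
    rw [mul_comm, ← div_eq_mul_inv]
    exact ENNReal.div_le_of_le_mul (hdouble k)
  have hstep : ∀ k, edist (m k) (m (k + 1)) ≤ D * a k := by
    intro k
    rw [edist_comm, edist_eq_enorm_sub]
    calc ‖m (k + 1) - m k‖ₑ
        ≤ (V (k + 1))⁻¹ * ∫⁻ y in ball x (ρ (k + 1)), ‖f y - m k‖ₑ ∂μ :=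
          enorm_setAverage_sub_le (hV0 _) (hV _) (hfk _) _
      _ ≤ (V (k + 1))⁻¹ * (V k * a k) := by
          gcongr
          exact (lintegral_mono_set (ball_subset_ball (hρa k.le_succ))).trans (hdev k)
      _ ≤ D * a k := by
          rw [← mul_assoc]
          gcongr
          exact hinv k
  have hcauchy : CauchySeq m := cauchySeq_of_edist_le_of_tsum_ne_top _ hstep (by
    rw [ENNReal.tsum_mul_left]
    exact ENNReal.mul_ne_top hD ha)
  obtain ⟨c, hc⟩ := cauchySeq_tendsto_of_complete hcauchy
  refine ⟨c, ?_⟩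
  have hlim : Tendsto (fun k => D * a k + edist (m k) c) atTop (𝓝 0) := by
    have h1 := ENNReal.Tendsto.const_mul (a := D)
      (ENNReal.tendsto_atTop_zero_of_tsum_ne_top ha) (Or.inr hD)
    have h2 := tendsto_iff_edist_tendsto_0.1 hc
    simpa using h1.add h2
  rw [ENNReal.tendsto_nhds_zero]
  intro ε hε
  obtain ⟨N, hN⟩ := eventually_atTop.1 (ENNReal.tendsto_nhds_zero.1 hlim ε hε)
  filter_upwards [Ioo_mem_nhdsGT (hρ N)] with r hr
  -- Trap `r` between consecutive radii, `ρ (k + 1) < r ≤ ρ k`; doubling then compares the two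
  -- averages.
  have hex : ∃ k, ρ k < r := ((tendsto_order.1 hρ0).2 r hr.1).exists
  have hfind := Nat.find_spec hex
  have hmin := fun j => Nat.find_min hex (m := j)
  generalize Nat.find hex = l at hfind hmin
  have hNl : N < l := by
    by_contra h
    exact (hfind.trans hr.2).not_ge (hρa (not_lt.1 h))
  obtain ⟨k, rfl⟩ : ∃ k, l = k + 1 := ⟨l - 1, by lia⟩
  have hrk : r ≤ ρ k := not_lt.1 (hmin k k.lt_succ_self)
  have hsub : ball x r ⊆ ball x (ρ k) := ball_subset_ball hrk
  have hsub' : ball x (ρ (k + 1)) ⊆ ball x r := ball_subset_ball hfind.le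
  have hr0 : μ (ball x r) ≠ 0 := fun h => hV0 (k + 1) (measure_mono_null hsub' h)
  have hrt : μ (ball x r) ≠ ∞ := ne_top_of_le_ne_top (hV k) (measure_mono hsub)
  refine le_trans ?_ (hN k (by lia))
  rw [setLAverage_eq, ENNReal.div_eq_inv_mul]
  calc (μ (ball x r))⁻¹ * ∫⁻ y in ball x r, ENNReal.ofReal |f y - c| ∂μ
      ≤ (μ (ball x r))⁻¹ * ∫⁻ y in ball x r, (‖f y - m k‖ₑ + edist (m k) c) ∂μ := by
        gcongr with y
        rw [← Real.enorm_eq_ofReal_abs, ← edist_eq_enorm_sub, ← edist_eq_enorm_sub]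
        exact edist_triangle _ _ _
    _ = (μ (ball x r))⁻¹ * (∫⁻ y in ball x r, ‖f y - m k‖ₑ ∂μ) + edist (m k) c := by
        rw [lintegral_add_right _ measurable_const, setLIntegral_const, mul_add,
          mul_comm (edist (m k) c), ← mul_assoc, ENNReal.inv_mul_cancel hr0 hrt, one_mul]
    _ ≤ (V (k + 1))⁻¹ * (V k * a k) + edist (m k) c := by
        gcongr
        · exact measure_mono hsub'
        · exact (lintegral_mono_set hsub).trans (hdev k)
    _ ≤ D * a k + edist (m k) c := by
        rw [← mul_assoc]
        gcongr
        exact hinv k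

/-! ### The energy kernel and the conclusion -/

/-- The integrand of the improved fractional Sobolev energy, extended by zero. -/
noncomputable def improvedKernel {n : ℕ} (δ τ : ℝ) (Ω : Set (EuclideanSpace ℝ (Fin n)))
    (f : EuclideanSpace ℝ (Fin n) → ℝ) (x y : EuclideanSpace ℝ (Fin n)) : ℝ≥0∞ :=
  {q : EuclideanSpace ℝ (Fin n) × EuclideanSpace ℝ (Fin n) |
      q.2 ∈ Ω ∧ q.1 ∈ nearSet τ Ω q.2}.indicator
    (fun q => ENNReal.ofReal (|f q.1 - f q.2| / dist q.1 q.2 ^ ((n : ℝ) + δ))) (x, y)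

theorem lintegral_improvedKernel_le {n : ℕ} (δ τ : ℝ) (Ω : Set (EuclideanSpace ℝ (Fin n)))
    (f : EuclideanSpace ℝ (Fin n) → ℝ) :
    ∫⁻ y, ∫⁻ x, improvedKernel δ τ Ω f x y ≤ improvedEnergy δ τ Ω f := by
  refine le_trans (lintegral_mono fun y => ?_) (lintegral_indicator_le _ Ω)
  by_cases hy : y ∈ Ω
  · rw [indicator_of_mem hy]
    refine le_trans (lintegral_mono fun x => ?_) (lintegral_indicator_le _ (nearSet τ Ω y))
    by_cases hx : x ∈ nearSet τ Ω y
    · rw [indicator_of_mem hx, improvedKernel, indicator_of_mem (by exact ⟨hy, hx⟩)]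
    · rw [improvedKernel, indicator_of_notMem fun h => hx h.2]
      exact zero_le
  · rw [indicator_of_notMem hy]
    have h : ∀ x, improvedKernel δ τ Ω f x y = 0 := fun x =>
      indicator_of_notMem (fun h => hy h.1) _
    simp [h]

/-- The near condition is open in the pair and holds at `(x, x)`, since an interior point has
positive, possibly infinite, distance to the boundary. -/
theorem exists_ball_prod_subset_near {n : ℕ} {τ : ℝ} (hτ : 0 < τ)
    {Ω : Set (EuclideanSpace ℝ (Fin n))} (hΩ : IsOpen Ω) {x : EuclideanSpace ℝ (Fin n)}
    (hx : x ∈ Ω) :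
    ∃ ε > 0, ball x ε ⊆ Ω ∧ ∀ y ∈ ball x ε, ∀ z ∈ ball x ε, z ∈ nearSet τ Ω y := by
  have hpos : 0 < infEDist x (frontier Ω) := by
    rw [pos_iff_ne_zero]
    intro h
    have h1 := mem_closure_iff_infEDist_zero.2 h
    rw [isClosed_frontier.closure_eq, hΩ.frontier_eq] at h1
    exact h1.2 hx
  have hopen : IsOpen {q : EuclideanSpace ℝ (Fin n) × EuclideanSpace ℝ (Fin n) |
      edist q.2 q.1 < ENNReal.ofReal τ * infEDist q.1 (frontier Ω)} := by
    refine isOpen_lt (continuous_snd.edist continuous_fst) ?_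
    exact (ENNReal.continuous_const_mul ENNReal.ofReal_ne_top).comp
      (continuous_infEDist.comp continuous_fst)
  have hnhds := (hopen.inter (hΩ.prod hΩ)).mem_nhds (x := (x, x))
    ⟨by simpa using ⟨hτ, hpos⟩, hx, hx⟩
  obtain ⟨ε, hε, hball⟩ := Metric.mem_nhds_iff.1 hnhds
  refine ⟨ε, hε, fun y hy => ?_, fun y hy z hz => ?_⟩
  · exact (hball (show (y, y) ∈ ball (x, x) ε by
      rw [← ball_prod_same]
      exact ⟨hy, hy⟩)).2.1
  · have h := hball (show (y, z) ∈ ball (x, x) ε by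
      rw [← ball_prod_same]
      exact ⟨hy, hz⟩)
    exact ⟨h.2.2, h.1⟩

theorem lintegral_ball_le_dyadicMean {n : ℕ} {δ τ : ℝ}
    {Ω : Set (EuclideanSpace ℝ (Fin n))} (f : EuclideanSpace ℝ (Fin n) → ℝ)
    {x : EuclideanSpace ℝ (Fin n)} {k : ℕ} (hΩ : ball x (2 ^ k)⁻¹ ⊆ Ω)
    (hnear : ∀ y ∈ ball x (2 ^ k)⁻¹, ∀ z ∈ ball x (2 ^ k)⁻¹, z ∈ nearSet τ Ω y) :
    ENNReal.ofReal (((2 : ℝ) ^ k) ^ (2 * (n : ℝ))) *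
        ∫⁻ y in ball x (2 ^ k)⁻¹, ∫⁻ z in ball x (2 ^ k)⁻¹, ‖f z - f y‖ₑ ≤
      dyadicMean (n + δ) (improvedKernel δ τ Ω f) k (dyadicIndex k x) := by
  rw [dyadicMean]
  refine mul_le_mul_right ?_ _
  rw [← lintegral_indicator measurableSet_ball]
  refine lintegral_mono fun y => ?_
  by_cases hy : y ∈ ball x (2 ^ k)⁻¹
  swap
  · rw [indicator_of_notMem hy]
    exact zero_le
  rw [indicator_of_mem hy, ← lintegral_indicator measurableSet_ball]
  refine lintegral_mono fun z => ?_
  by_cases hz : z ∈ ball x (2 ^ k)⁻¹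
  swap
  · rw [indicator_of_notMem hz]
    exact zero_le
  rw [indicator_of_mem hz, indicator_of_mem (by
    exact ⟨mem_dyadicNbhd_of_dist_lt hz, mem_dyadicNbhd_of_dist_lt hy⟩), improvedKernel,
    indicator_of_mem (by exact ⟨hΩ hy, hnear y hy z hz⟩),
    ← ENNReal.ofReal_mul (by positivity), Real.enorm_eq_ofReal_abs]
  refine ENNReal.ofReal_le_ofReal ?_
  -- On the diagonal the power cannot be cancelled, but the oscillation vanishes.
  rcases eq_or_ne z y with rfl | hzy
  · simp
  · rw [mul_div_cancel₀ _ (Real.rpow_pos_of_pos (dist_pos.2 hzy) _).ne']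

theorem mem_lebesguePoints_of_tsum_dyadicMean_ne_top {n : ℕ} {δ τ : ℝ}
    (hτ : 0 < τ) {Ω : Set (EuclideanSpace ℝ (Fin n))} (hΩ : IsOpen Ω)
    {f : EuclideanSpace ℝ (Fin n) → ℝ} (hf : IntegrableOn f Ω) {x : EuclideanSpace ℝ (Fin n)}
    (hx : x ∈ Ω)
    (hsum : ∑' k, dyadicMean (n + δ) (improvedKernel δ τ Ω f) k (dyadicIndex k x) ≠ ∞) :
    x ∈ lebesguePoints Ω f := by
  refine ⟨hx, ?_⟩
  obtain ⟨ε, hε, hball, hnear⟩ := exists_ball_prod_subset_near hτ hΩ hx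
  obtain ⟨K, hK⟩ := exists_pow_lt_of_lt_one hε (by norm_num : (2⁻¹ : ℝ) < 1)
  rw [inv_pow] at hK
  set A : ℕ → ℝ≥0∞ := fun k =>
    dyadicMean (n + δ) (improvedKernel δ τ Ω f) k (dyadicIndex k x) with hA
  set v : ℝ≥0∞ := volume (ball (0 : EuclideanSpace ℝ (Fin n)) 1)
  have hv0 : v ≠ 0 := (measure_ball_pos _ _ one_pos).ne'
  have hvt : v ≠ ∞ := measure_ball_lt_top.ne
  have hvol : ∀ k : ℕ, volume (ball x ((2 ^ k)⁻¹ : ℝ)) = ENNReal.ofReal ((2 ^ k)⁻¹ ^ n) * v := by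
    intro k
    rw [Measure.addHaar_ball_of_pos _ _ (by positivity), finrank_euclideanSpace_fin]
  have hanti : Antitone fun k : ℕ => ((2 : ℝ) ^ (k + K))⁻¹ := fun j k hjk => by
    dsimp only
    gcongr
    norm_num
  have hle : ∀ k : ℕ, ((2 : ℝ) ^ (k + K))⁻¹ ≤ ε := fun k =>
    (hanti k.zero_le).trans (by simpa using hK.le)
  have hlim : Tendsto (fun k : ℕ => ((2 : ℝ) ^ (k + K))⁻¹) atTop (𝓝 0) := by
    have h := tendsto_pow_atTop_nhds_zero_of_lt_one (by norm_num) (by norm_num : (2⁻¹ : ℝ) < 1)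
    simpa using (tendsto_add_atTop_iff_nat K).2 h
  -- `D = 2 ^ n` comes from halving the radius, `v⁻¹ * v⁻¹` turns the factor `2 ^ (2 n k)` into
  -- division by the squared ball volume, and the shift by `K` keeps all balls where the near
  -- condition holds.
  refine exists_tendsto_setLAverage_of_tsum_oscillation (D := 2 ^ n)
    (a := fun k => v⁻¹ * v⁻¹ * A (k + K)) (fun k => by positivity) hanti hlim (by simp)
    (fun k => (measure_ball_pos _ _ (by positivity)).ne') (fun k => measure_ball_lt_top.ne)
    (fun k => ?_) (hf.mono_set ((ball_subset_ball (hle 0)).trans hball)) (fun k => ?_) ?_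
  · rw [hvol, hvol, ← mul_assoc]
    gcongr
    rw [← ENNReal.ofReal_ofNat, ← ENNReal.ofReal_pow (by norm_num),
      ← ENNReal.ofReal_mul (by positivity), ← mul_pow]
    refine ENNReal.ofReal_le_ofReal (le_of_eq ?_)
    congr 1
    rw [show k + 1 + K = k + K + 1 by ring, pow_succ (2 : ℝ) (k + K)]
    field_simp
  · have hsub := ball_subset_ball (x := x) (hle k)
    have h1 := lintegral_ball_le_dyadicMean (δ := δ) f (hsub.trans hball)
      fun y hy z hz => hnear y (hsub hy) z (hsub hz)
    rw [hvol]
    generalize k + K = j at h1 ⊢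
    set I := ∫⁻ y in ball x (2 ^ j)⁻¹, ∫⁻ z in ball x (2 ^ j)⁻¹, ‖f z - f y‖ₑ
    have h2 : ENNReal.ofReal ((2 ^ j)⁻¹ ^ n) * ENNReal.ofReal ((2 ^ j)⁻¹ ^ n) *
        ENNReal.ofReal (((2 : ℝ) ^ j) ^ (2 * (n : ℝ))) = 1 := by
      have h3 : ((2 : ℝ) ^ j) ^ (2 * (n : ℝ)) = (2 ^ j) ^ n * (2 ^ j) ^ n := by
        rw [two_mul, Real.rpow_add (by positivity), Real.rpow_natCast]
      rw [← ENNReal.ofReal_mul (by positivity), ← ENNReal.ofReal_mul (by positivity), h3,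
        ← ENNReal.ofReal_one]
      congr 1
      rw [inv_pow]
      field_simp
    calc I = ENNReal.ofReal ((2 ^ j)⁻¹ ^ n) * ENNReal.ofReal ((2 ^ j)⁻¹ ^ n) *
          (ENNReal.ofReal (((2 : ℝ) ^ j) ^ (2 * (n : ℝ))) * I) := by
          rw [← mul_assoc, h2, one_mul]
      _ ≤ ENNReal.ofReal ((2 ^ j)⁻¹ ^ n) * ENNReal.ofReal ((2 ^ j)⁻¹ ^ n) * A j := by
          gcongr
      _ = ENNReal.ofReal ((2 ^ j)⁻¹ ^ n) * ENNReal.ofReal ((2 ^ j)⁻¹ ^ n) *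
          (v * v⁻¹ * (v * v⁻¹) * A j) := by
          rw [ENNReal.mul_inv_cancel hv0 hvt, one_mul, one_mul]
      _ = _ := by ring
  · rw [ENNReal.tsum_mul_left]
    refine ENNReal.mul_ne_top (by simp [ENNReal.mul_eq_top, hv0]) ?_
    exact ne_top_of_le_ne_top hsum (ENNReal.tsum_comp_le_tsum_of_injective
      (add_left_injective K) A)

theorem hausdorffContent_mono {n : ℕ} {α : ℝ} {U V : Set (EuclideanSpace ℝ (Fin n))}
    (h : U ⊆ V) : hausdorffContent α U ≤ hausdorffContent α V :=
  iInf₂_mono fun _ _ => iInf_mono fun _ => iInf_mono' fun hV => ⟨h.trans hV, le_rfl⟩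

theorem mainTheorem10 (n : ℕ) (hn : 2 ≤ n) (δ τ β : ℝ) (hδ : δ ∈ Set.Ioo (0 : ℝ) 1)
    (hτ : τ ∈ Set.Ioo (0 : ℝ) 1) (hβ : (n : ℝ) - δ ≤ β)
    (Ω : Set (EuclideanSpace ℝ (Fin n))) (hΩo : IsOpen Ω) (hΩc : IsConnected Ω)
    (f : EuclideanSpace ℝ (Fin n) → ℝ) (hf : f ∈ improvedSobolev δ τ Ω) :
    hausdorffContent β (Ω \ lebesguePoints Ω f) = 0 := by
  have hn' : (2 : ℝ) ≤ n := by exact_mod_cast hn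
  have : NeZero n := ⟨by lia⟩
  obtain ⟨hδ0, hδ1⟩ := hδ
  set A := dyadicMean ((n : ℝ) + δ) (improvedKernel δ τ Ω f)
  have hA : ∑' i : ℕ × (Fin n → ℤ),
      ENNReal.ofReal (((2 : ℝ) ^ i.1) ^ (-((n : ℝ) - δ))) * A i.1 i.2 ≠ ∞ := by
    have h := tsum_dyadicMean_le (p := n + δ) (by linarith) (improvedKernel δ τ Ω f)
    -- This is the origin of the critical dimension `n - δ`.
    rw [show (n : ℝ) + δ - 2 * n = -(n - δ) by ring] at h
    refine ne_top_of_le_ne_top (ENNReal.mul_ne_top ?_ ?_) h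
    · exact ENNReal.mul_ne_top (by simp) ENNReal.ofReal_ne_top
    · exact ((lintegral_improvedKernel_le δ τ Ω f).trans_lt hf.2).ne
  refine le_antisymm ?_ zero_le
  rw [← hausdorffContent_dyadic_sum_eq_top (by linarith) hβ A hA]
  refine hausdorffContent_mono fun x hx => ?_
  by_contra h
  exact hx.2 (mem_lebesguePoints_of_tsum_dyadicMean_ne_top hτ.1 hΩo hf.1 hx.1 h)
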